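/- Let $E$ be a Lusin topological space (a homeomorph of a Borel subset of a compact metric space), let $M(E)$ be the space of finite Borel measures on $E$ with the topology of weak convergence, and let $B(E)$ be the bounded Borel functions on $E$, $B(E)^+$ the nonnegative ones. Write $\mu(f)=\int f\,d\mu$, $L_P(f)=\int_{M(E)}e^{-\nu(f)}P(d\nu)$, and, for probability measures $P_1,P_2$ on $M(E)$, $$W_1(P_1,P_2)=\inf_P\int_{M(E)^2}|\mu-\nu|(E)\,P(d\mu,d\nu),$$ where $P$ runs over the couplings of $P_1$ and $P_2$ and $|\mu-\nu|$ is the total variation of $\mu-\nu$. Let $(Q_t)_{t\ge0}$ be the transition semigroup of a conservative measure-valued branching process: Markov kernels on $M(E)$ with $Q_0=\mathrm{id}$, $Q_sQ_t=Q_{s+t}$ and $\int e^{-\nu(f)}Q_t(\mu,d\nu)=e^{-\mu(V_tf)}$ for $\mu\in M(E)$, $f\in B(E)^+$, where $V_tf(x)=-\log\int e^{-\nu(f)}Q_t(\delta_x,d\nu)$. Assume that for all $t\ge0$ and $f\in B(E)$ the function $\pi_tf(x)=\int\nu(f)\,Q_t(\delta_x,d\nu)$ is well defined and bounded on $E$.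 Let $(K_s)_{s>0}$ be an infinitely divisible probability entrance law for $(Q_t)$, that is, infinitely divisible probability measures on $M(E)$ with $K_{s+t}=K_sQ_t$ for $s>0$, $t\ge 0$, such that $s\mapsto\log L_{K_s}(f)$ is Lebesgue measurable on $(0,\infty)$ for every $f\in B(E)^+$ and $-\int_0^t\log L_{K_s}(1)\,ds<\infty$ for every $t\ge0$. Let $(N_t)_{t\ge0}$ be the skew convolution semigroup given by $(K_s)$: probability measures on $M(E)$ with $N_{r+t}=(N_rQ_t)*N_t$ for $r,t\ge0$ and $$L_{N_t}(f)=\exp\Big\{\int_0^t\log L_{K_s}(f)\,ds\Big\},\qquad t\ge0,\ f\in B(E)^+.$$ Suppose that $$\int_0^\infty ds\int_{M(E)}\nu(1)\,K_s(d\nu)<\infty .$$ Then $N_t$ converges weakly as $t\to\infty$ to a probability measure $N_\infty$ on $M(E)$, and for every $t\ge0$ $$W_1(N_t,N_\infty)=\int_t^\infty ds\int_{M(E)}\nu(1)\,K_s(d\nu)=\int_{M(E)}\nu(\pi_t1)\,N_\infty(d\nu).$$ -/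

import Mathlib

open MeasureTheory ProbabilityTheory Filter Topology Set
open scoped ENNReal

universe u

noncomputable section

namespace MBI

/-- A Lusin topological space: a homeomorph of a Borel subset of a compact metric space. -/
def IsLusin (E : Type u) [TopologicalSpace E] : Prop :=
  ∃ (X : Type u) (_ : MetricSpace X) (_ : CompactSpace X) (φ : E → X),
    IsEmbedding φ ∧ MeasurableSet[borel X] (range φ)

section

variable {E : Type u} [MeasurableSpace E]

/-- The set `B(E)` of bounded Borel functions. -/
def IsBddBorel (f : E → ℝ) : Prop :=
  Measurable f ∧ ∃ C : ℝ, ∀ x, |f x| ≤ C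

/-- The set `B(E)⁺` of nonnegative bounded Borel functions. -/
def IsBddBorelNonneg (f : E → ℝ) : Prop :=
  IsBddBorel f ∧ ∀ x, 0 ≤ f x

/-- The Dirac measure at `x`, as an element of `M(E)`. -/
def diracM (x : E) : FiniteMeasure E := ⟨Measure.dirac x, inferInstance⟩

/-- The Laplace functional `L_P(f) = ∫ exp(-ν(f)) P(dν)` of a measure `P` on `M(E)`.
Here `M(E) = FiniteMeasure E` carries the σ-algebra generated by the evaluations `ν ↦ ν(A)`;
for a Lusin space `E` it is the Borel σ-algebra of the topology of weak convergence. -/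
def laplace (P : Measure (FiniteMeasure E)) (f : E → ℝ) : ℝ :=
  ∫ ν, Real.exp (-∫ x, f x ∂(ν : Measure E)) ∂P

/-- The total variation distance `|μ - ν|(E)`. -/
def tvDist (μ ν : FiniteMeasure E) : ℝ≥0∞ :=
  ((μ : Measure E).toSignedMeasure - (ν : Measure E).toSignedMeasure).totalVariation univ

/-- `P` is a coupling of `P₁` and `P₂`. -/
structure IsCoupling (P : Measure (FiniteMeasure E × FiniteMeasure E))
    (P₁ P₂ : Measure (FiniteMeasure E)) : Prop where
  isProbabilityMeasure : IsProbabilityMeasure P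
  map_fst : P.map Prod.fst = P₁
  map_snd : P.map Prod.snd = P₂

/-- The Wasserstein distance for the total variation distance on `M(E)`. -/
def W₁ (P₁ P₂ : Measure (FiniteMeasure E)) : ℝ≥0∞ :=
  ⨅ (P : Measure (FiniteMeasure E × FiniteMeasure E)) (_ : IsCoupling P P₁ P₂),
    ∫⁻ p, tvDist p.1 p.2 ∂P

/-- The cumulant operator `V_t f(x) = -log ∫ exp(-ν(f)) Q_t(δ_x, dν)`. -/
def cumulant (Q : ℝ → Kernel (FiniteMeasure E) (FiniteMeasure E)) (t : ℝ) (f : E → ℝ) (x : E) : ℝ :=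
  -Real.log (laplace (Q t (diracM x)) f)

/-- `(Q_t)_{t ≥ 0}` is the (conservative) transition semigroup of a measure-valued branching
process: Markov kernels on `M(E)` with `Q_0 = id` and the Chapman-Kolmogorov equations, satisfying
the regular branching property. Only the values at times `t ≥ 0` matter. -/
structure IsMBSemigroup (Q : ℝ → Kernel (FiniteMeasure E) (FiniteMeasure E)) : Prop where
  isMarkovKernel : ∀ t, 0 ≤ t → IsMarkovKernel (Q t)
  zero : Q 0 = Kernel.id
  add : ∀ s t, 0 ≤ s → 0 ≤ t → ∀ μ, Q (s + t) μ = (Q s μ).bind (Q t)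
  integrable_cumulant : ∀ t, 0 ≤ t → ∀ (μ : FiniteMeasure E) (f : E → ℝ), IsBddBorelNonneg f →
    Integrable (cumulant Q t f) (μ : Measure E)
  branching : ∀ t, 0 ≤ t → ∀ (μ : FiniteMeasure E) (f : E → ℝ), IsBddBorelNonneg f →
    laplace (Q t μ) f = Real.exp (-∫ x, cumulant Q t f x ∂(μ : Measure E))

/-- The first moment operator `π_t f(x) = ∫ ν(f) Q_t(δ_x, dν)`. -/
def moment (Q : ℝ → Kernel (FiniteMeasure E) (FiniteMeasure E)) (t : ℝ) (f : E → ℝ) (x : E) : ℝ :=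
  ∫ ν, (∫ y, f y ∂(ν : Measure E)) ∂(Q t (diracM x))

/-- For all `t ≥ 0` and `f ∈ B(E)`, the function `π_t f` is well defined and bounded on `E`. -/
def BoundedMoments (Q : ℝ → Kernel (FiniteMeasure E) (FiniteMeasure E)) : Prop :=
  ∀ t, 0 ≤ t → ∀ f : E → ℝ, IsBddBorel f →
    (∀ x, Integrable (fun ν : FiniteMeasure E => ∫ y, f y ∂(ν : Measure E)) (Q t (diracM x))) ∧
    ∃ C : ℝ, ∀ x, |moment Q t f x| ≤ C

/-- The `n`-fold convolution power of a measure on `M(E)`. -/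
def convPow (R : Measure (FiniteMeasure E)) : ℕ → Measure (FiniteMeasure E)
  | 0 => Measure.dirac 0
  | n + 1 => (convPow R n).conv R

/-- Infinite divisibility of a probability measure on `M(E)`. -/
def IsInfinitelyDivisible (P : Measure (FiniteMeasure E)) : Prop :=
  ∀ n : ℕ, 0 < n → ∃ R : Measure (FiniteMeasure E), IsProbabilityMeasure R ∧ convPow R n = P

/-- `(K_t)_{t > 0}` is an infinitely divisible probability entrance law for `(Q_t)_{t ≥ 0}`.
Only the values at times `t > 0` matter. -/
structure IsInfDivEntranceLaw (Q : ℝ → Kernel (FiniteMeasure E) (FiniteMeasure E))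
    (K : ℝ → Measure (FiniteMeasure E)) : Prop where
  isProbabilityMeasure : ∀ s, 0 < s → IsProbabilityMeasure (K s)
  infinitelyDivisible : ∀ s, 0 < s → IsInfinitelyDivisible (K s)
  entrance : ∀ s t, 0 < s → 0 ≤ t → K (s + t) = (K s).bind (Q t)

/-- `I_s(K, f) = -log L_{K_s}(f)`. -/
def logLaplace (K : ℝ → Measure (FiniteMeasure E)) (s : ℝ) (f : E → ℝ) : ℝ :=
  -Real.log (laplace (K s) f)

/-- The integrability condition `-∫_0^t log L_{K_s}(1) ds < ∞` for all `t ≥ 0`, together with the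
measurability in time which makes `∫_0^t I_s(K, f) ds` meaningful for `f ∈ B(E)⁺`. -/
structure IsLogIntegrable (K : ℝ → Measure (FiniteMeasure E)) : Prop where
  aemeasurable : ∀ f : E → ℝ, IsBddBorelNonneg f →
    AEMeasurable (fun s => logLaplace K s f) (volume.restrict (Ioi 0))
  lintegral_lt_top : ∀ t, 0 ≤ t →
    ∫⁻ s in Ioc 0 t, ENNReal.ofReal (logLaplace K s (fun _ => 1)) < ∞

/-- `(N_t)_{t ≥ 0}` is a skew convolution semigroup associated with `(Q_t)_{t ≥ 0}`:
`N_{r+t} = (N_r Q_t) * N_t`. -/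
structure IsSCSemigroup (Q : ℝ → Kernel (FiniteMeasure E) (FiniteMeasure E))
    (N : ℝ → Measure (FiniteMeasure E)) : Prop where
  isProbabilityMeasure : ∀ t, 0 ≤ t → IsProbabilityMeasure (N t)
  skew : ∀ r t, 0 ≤ r → 0 ≤ t → N (r + t) = ((N r).bind (Q t)).conv (N t)

/-- `(N_t)_{t ≥ 0}` is represented by `(K_t)_{t > 0}`:
`L_{N_t}(f) = exp(-∫_0^t I_s(K, f) ds)` for `t ≥ 0` and `f ∈ B(E)⁺`. -/
def IsGivenBy (N K : ℝ → Measure (FiniteMeasure E)) : Prop :=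
  ∀ t, 0 ≤ t → ∀ f : E → ℝ, IsBddBorelNonneg f →
    laplace (N t) f = Real.exp (-∫ s in Ioc 0 t, logLaplace K s f)

/-- The first moment `∫ ν(1) P(dν)`. -/
def firstMoment (P : Measure (FiniteMeasure E)) : ℝ≥0∞ :=
  ∫⁻ ν, (ν : Measure E) univ ∂P

/-- Weak convergence `N_t → P` as `t → ∞`, for measures on the topological space `M(E)`
(with its own topology of weak convergence): convergence of integrals of bounded continuous
functions on `M(E)`. -/
def WeakLimit [TopologicalSpace E] [OpensMeasurableSpace E]
    (N : ℝ → Measure (FiniteMeasure E)) (P : Measure (FiniteMeasure E)) : Prop :=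
  ∀ F : BoundedContinuousFunction (FiniteMeasure E) ℝ,
    Tendsto (fun t => ∫ ν, F ν ∂(N t)) atTop (𝓝 (∫ ν, F ν ∂P))

end

end MBI

end

/-! Write `m s` for the first moment of `K s`. For times `v 0 ≤ v 1 ≤ ...` tending to infinity, the
skew identity exhibits `N (v n)` as the law of a partial sum of independent random measures: the
first has law `N (v 0)`, the next ones the laws `N (v (k + 1) - v k)` transported by `Q (v k)`. The
expected masses of these later terms are the integrals of `m` over consecutive intervals `(v k, v (k
+ 1)]`, so the series has finite expected mass and converges almost surely. Its law is the limit
(`exists_limit_of_monotone`).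

With `v 0 = t`, the pair (first term, whole series) couples `N t` with the limit. The difference is
a positive measure, so the cost is the expected mass of the tail, the integral of `m` over `(t, ∞)`
(`W₁_map_seriesSum_le`). No coupling does better, since total variation dominates the difference of
masses (`firstMoment_le_add_W₁`). The second equality follows by applying `Q t` to the series term
by term.

The moments themselves come from the Laplace functionals, differentiated at zero
(`firstMoment_eq_lintegral`). Since `M(E)` carries the σ-algebra of evaluations, its compatibility
with weak convergence has to be proved; this is where the embedding into a compact metric space
enters. -/

namespace MBI


/-! ### Weak topology and evaluation σ-algebra on `M(E)` -/

section Topology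

/-- The hypothesis is sequential continuity for the topology induced by `T`. That topology is first
countable, so `F` is continuous, and its open sets are preimages of open sets under the measurable
map `T`. -/
theorem measurable_of_seq_tendsto {S Y : Type*} [MeasurableSpace S] [TopologicalSpace Y]
    [FirstCountableTopology Y] [MeasurableSpace Y] [OpensMeasurableSpace Y] {T : S → Y}
    (hT : Measurable T) {F : S → ℝ}
    (h : ∀ (x : ℕ → S) (a : S), Tendsto (fun n => T (x n)) atTop (𝓝 (T a)) →
      Tendsto (fun n => F (x n)) atTop (𝓝 (F a))) : Measurable F := by
  let : TopologicalSpace S := TopologicalSpace.induced T inferInstance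
  have hind : IsInducing T := ⟨rfl⟩
  have : FirstCountableTopology S := hind.firstCountableTopology
  have hF : Continuous F := by
    refine continuous_iff_seqContinuous.2 fun x a hx => h x a ?_
    exact (hind.continuous.tendsto a).comp hx
  refine measurable_of_isOpen fun U hU => ?_
  obtain ⟨V, hV, hVU⟩ := isOpen_induced_iff.1 (hU.preimage hF)
  rw [← hVU]
  exact hT hV.measurableSet

theorem IsLusin.hasOuterApproxClosed {E : Type u} [TopologicalSpace E] (hE : IsLusin E) : HasOuterApproxClosed E := by
  obtain ⟨X, _, _, φ, hφ, -⟩ := hE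
  let : MetricSpace E := hφ.comapMetricSpace φ
  infer_instance

variable {E : Type u} [MeasurableSpace E]

theorem measurable_toMeasure :
    Measurable (fun ν : FiniteMeasure E => (ν : Measure E)) := measurable_subtype_coe

theorem measurable_lintegral_toMeasure {g : E → ℝ≥0∞} (hg : Measurable g) :
    Measurable (fun ν : FiniteMeasure E => ∫⁻ x, g x ∂(ν : Measure E)) :=
  (Measure.measurable_lintegral hg).comp measurable_toMeasure

theorem measurable_toMeasure_apply {s : Set E} (hs : MeasurableSet s) :
    Measurable (fun ν : FiniteMeasure E => (ν : Measure E) s) :=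
  (Measure.measurable_coe hs).comp measurable_toMeasure

theorem measurable_integral_toMeasure {g : E → ℝ} (hg : Measurable g) (hb : ∃ C, ∀ x, |g x| ≤ C) :
    Measurable (fun ν : FiniteMeasure E => ∫ x, g x ∂(ν : Measure E)) := by
  obtain ⟨C, hC⟩ := hb
  have : (fun ν : FiniteMeasure E => ∫ x, g x ∂(ν : Measure E)) = fun ν : FiniteMeasure E =>
      (∫⁻ x, ENNReal.ofReal (g x) ∂(ν : Measure E)).toReal -
        (∫⁻ x, ENNReal.ofReal (-g x) ∂(ν : Measure E)).toReal := by
    funext ν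
    refine integral_eq_lintegral_pos_part_sub_lintegral_neg_part ?_
    exact Integrable.of_bound hg.aestronglyMeasurable C (ae_of_all _ hC)
  rw [this]
  exact (measurable_lintegral_toMeasure hg.ennreal_ofReal).ennreal_toReal.sub
    (measurable_lintegral_toMeasure hg.neg.ennreal_ofReal).ennreal_toReal

variable [TopologicalSpace E] [BorelSpace E]

theorem eventually_le_add_of_le_liminf {a : ℝ≥0∞} {u : ℕ → ℝ≥0∞} (ha : a ≠ ∞)
    (h : a ≤ atTop.liminf u) {ε : ℝ≥0∞} (hε : ε ≠ 0) : ∀ᶠ n in atTop, a ≤ u n + ε := by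
  rcases eq_or_ne a 0 with rfl | h0
  · exact Eventually.of_forall fun _ => zero_le
  · have hlt : a - ε < atTop.liminf u := (ENNReal.sub_lt_self ha h0 hε).trans_le h
    filter_upwards [eventually_lt_of_lt_liminf hlt] with n hn
    exact tsub_le_iff_right.1 hn.le

theorem le_liminf_of_tendsto_add {a b : ℝ≥0∞} {u v : ℕ → ℝ≥0∞} (ha : a ≠ ∞) (hb : b ≠ ∞)
    (h : Tendsto (fun n => u n + v n) atTop (𝓝 (a + b))) (hv : atTop.limsup v ≤ b) :
    a ≤ atTop.liminf u := by
  refine ENNReal.le_of_forall_pos_le_add fun ε hε _ => ?_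
  have hε' : ((ε / 2 : NNReal) : ℝ≥0∞) ≠ 0 := by simpa using hε.ne'
  rw [← tsub_le_iff_right]
  refine le_liminf_of_le (by isBoundedDefault) ?_
  have hlt : atTop.limsup v < b + (ε / 2 : NNReal) :=
    hv.trans_lt (ENNReal.lt_add_right hb hε')
  filter_upwards [eventually_lt_of_limsup_lt hlt,
    (ENNReal.tendsto_nhds (ENNReal.add_ne_top.2 ⟨ha, hb⟩)).1 h _ (pos_iff_ne_zero.2 hε')]
    with n h1 h2
  rw [tsub_le_iff_right]
  refine (ENNReal.add_le_add_iff_right hb).1 ?_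
  calc a + b ≤ u n + v n + (ε / 2 : NNReal) := tsub_le_iff_right.1 h2.1
    _ ≤ u n + (b + (ε / 2 : NNReal)) + (ε / 2 : NNReal) := by gcongr
    _ = u n + b + ((ε / 2 + ε / 2 : NNReal) : ℝ≥0∞) := by push_cast; ring
    _ = u n + ε + b := by rw [add_halves]; ring

theorem limsup_le_of_tendsto_add {a b : ℝ≥0∞} {u v : ℕ → ℝ≥0∞} (ha : a ≠ ∞) (hb : b ≠ ∞)
    (hfin : ∀ n, v n ≠ ∞)
    (h : Tendsto (fun n => u n + v n) atTop (𝓝 (a + b))) (hv : b ≤ atTop.liminf v) :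
    atTop.limsup u ≤ a := by
  refine ENNReal.le_of_forall_pos_le_add fun ε hε _ => ?_
  have hε' : ((ε / 2 : NNReal) : ℝ≥0∞) ≠ 0 := by simpa using hε.ne'
  refine limsup_le_of_le (by isBoundedDefault) ?_
  filter_upwards [eventually_le_add_of_le_liminf hb hv hε',
    (ENNReal.tendsto_nhds (ENNReal.add_ne_top.2 ⟨ha, hb⟩)).1 h _ (pos_iff_ne_zero.2 hε')]
    with n h1 h2
  refine (ENNReal.add_le_add_iff_right (hfin n)).1 ?_
  calc u n + v n ≤ a + b + (ε / 2 : NNReal) := h2.2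
    _ ≤ a + (v n + (ε / 2 : NNReal)) + (ε / 2 : NNReal) := by gcongr
    _ = a + v n + ((ε / 2 + ε / 2 : NNReal) : ℝ≥0∞) := by push_cast; ring
    _ = a + ε + v n := by rw [add_halves]; ring

/-- Convergence of the total masses together with the portmanteau inequality for closed sets
implies weak convergence of finite measures. -/
theorem tendsto_of_tendsto_mass_of_limsup_le {ν : ℕ → FiniteMeasure E} {ν₀ : FiniteMeasure E}
    (hmass : Tendsto (fun n => (ν n : Measure E) univ) atTop (𝓝 ((ν₀ : Measure E) univ)))
    (hF : ∀ F : Set E, IsClosed F →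
      atTop.limsup (fun n => (ν n : Measure E) F) ≤ (ν₀ : Measure E) F) :
    Tendsto ν atTop (𝓝 ν₀) := by
  have hopen : ∀ G : Set E, IsOpen G →
      (ν₀ : Measure E) G ≤ atTop.liminf (fun n => (ν n : Measure E) G) := by
    intro G hG
    refine le_liminf_of_tendsto_add (measure_ne_top _ _) (measure_ne_top _ _) ?_
      (hF Gᶜ hG.isClosed_compl)
    simpa only [measure_add_measure_compl hG.measurableSet] using hmass
  have hlow : ∀ f : E → ℝ, Continuous f → 0 ≤ f → ∫⁻ x, ENNReal.ofReal (f x) ∂(ν₀ : Measure E) ≤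
      atTop.liminf fun n => ∫⁻ x, ENNReal.ofReal (f x) ∂(ν n : Measure E) := fun f hf hf0 =>
    lintegral_le_liminf_lintegral_of_forall_isOpen_measure_le_liminf_measure hf hf0 hopen
  refine FiniteMeasure.tendsto_iff_forall_lintegral_tendsto.2 fun f => ?_
  have hfc : Continuous fun x => (f x : ℝ) := NNReal.continuous_coe.comp f.continuous
  -- `g` is the complement of `f` in the constant `‖f‖`: the liminf bound for `g`, together with
  -- convergence of masses, is the limsup bound for `f`.
  set g : E → ℝ := fun x => dist f 0 - f x with hg
  have hg0 : 0 ≤ g := fun x => sub_nonneg.2 (by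
    simpa [NNReal.dist_eq] using f.dist_coe_le_dist (g := 0) x)
  have hgc : Continuous g := continuous_const.sub hfc
  have h1 := hlow _ hfc fun x => (f x).2
  have h2 := hlow g hgc hg0
  simp only [ENNReal.ofReal_coe_nnreal] at h1
  have hgfin : ∀ μ : FiniteMeasure E, ∫⁻ x, ENNReal.ofReal (g x) ∂(μ : Measure E) ≠ ∞ := by
    intro μ
    refine ne_of_lt (lt_of_le_of_lt (lintegral_mono (g := fun _ => ENNReal.ofReal (dist f 0))
      fun x => ENNReal.ofReal_le_ofReal (by simp [hg])) ?_)
    simpa using ENNReal.mul_lt_top ENNReal.ofReal_lt_top (measure_lt_top _ _)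
  have hsum : ∀ μ : FiniteMeasure E, ∫⁻ x, f x ∂(μ : Measure E) +
      ∫⁻ x, ENNReal.ofReal (g x) ∂(μ : Measure E) = ENNReal.ofReal (dist f 0) * (μ : Measure E) univ := by
    intro μ
    rw [← lintegral_add_right _ hgc.measurable.ennreal_ofReal, ← lintegral_const]
    refine lintegral_congr fun x => ?_
    rw [← ENNReal.ofReal_coe_nnreal, ← ENNReal.ofReal_add (NNReal.coe_nonneg _) (hg0 x)]
    simp [hg]
  refine tendsto_of_le_liminf_of_limsup_le h1 ?_
  refine limsup_le_of_tendsto_add (f.lintegral_lt_top_of_nnreal _).ne (hgfin ν₀)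
    (fun n => hgfin (ν n)) ?_ h2
  simp only [hsum]
  exact ENNReal.Tendsto.const_mul hmass (Or.inr ENNReal.ofReal_ne_top)

/-- Density and bounded masses give weak convergence of the images on `X`. Closed sets of `E` are
traces of closed sets of `X`, so the portmanteau inequality pulls back to `E`. -/
theorem tendsto_of_tendsto_integral_comp {X : Type*} [MetricSpace X] [CompactSpace X] {φ : E → X}
    (hφ : IsEmbedding φ) {g : ℕ → C(X, ℝ)} (hg : DenseRange g) {ν : ℕ → FiniteMeasure E}
    {ν₀ : FiniteMeasure E}
    (hmass : Tendsto (fun n => (ν n : Measure E) univ) atTop (𝓝 ((ν₀ : Measure E) univ)))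
    (h : ∀ k, Tendsto (fun n => ∫ x, g k (φ x) ∂(ν n : Measure E)) atTop
      (𝓝 (∫ x, g k (φ x) ∂(ν₀ : Measure E)))) :
    Tendsto ν atTop (𝓝 ν₀) := by
  borelize X
  have hφm : Measurable φ := hφ.continuous.measurable
  have hmap : Tendsto (fun n => (ν n).map φ) atTop (𝓝 (ν₀.map φ)) := by
    refine FiniteMeasure.tendsto_iff_forall_integral_tendsto.2 fun f => ?_
    have hint : ∀ (μ : FiniteMeasure E) (f : C(X, ℝ)),
        Integrable (fun x => f (φ x)) (μ : Measure E) := fun μ f =>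
      Integrable.of_bound (f.continuous.comp hφ.continuous).measurable.aestronglyMeasurable ‖f‖
        (ae_of_all _ fun x => f.norm_coe_le_norm _)
    have hclose : ∀ (μ : FiniteMeasure E) (f₁ f₂ : C(X, ℝ)),
        dist (∫ x, f₁ (φ x) ∂(μ : Measure E)) (∫ x, f₂ (φ x) ∂(μ : Measure E)) ≤
          dist f₁ f₂ * (μ : Measure E).real univ := by
      intro μ f₁ f₂
      rw [dist_eq_norm, ← integral_sub (hint _ _) (hint _ _)]
      refine norm_integral_le_of_norm_le_const (ae_of_all _ fun x => ?_)
      rw [← dist_eq_norm]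
      exact ContinuousMap.dist_apply_le_dist _
    have hm : Tendsto (fun n => (ν n : Measure E).real univ) atTop
        (𝓝 ((ν₀ : Measure E).real univ)) :=
      (ENNReal.tendsto_toReal (measure_ne_top _ _)).comp hmass
    simp only [FiniteMeasure.toMeasure_map]
    simp_rw [integral_map hφm.aemeasurable f.continuous.measurable.aestronglyMeasurable]
    rw [Metric.tendsto_atTop']
    intro ε hε
    set c := (ν₀ : Measure E).real univ + 1 with hc
    have hc0 : 0 < c := by positivity
    -- `c` eventually bounds all the masses, so replacing `f` by `g k` costs at most `ε / 4` on each
    -- side and leaves `ε / 2` for the convergence.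
    obtain ⟨k, hk⟩ := hg.exists_dist_lt f.toContinuousMap (ε := ε / (4 * c)) (by positivity)
    have h1 := (Metric.tendsto_atTop'.1 (h k)) (ε / 2) (by positivity)
    obtain ⟨n₁, hn₁⟩ := h1
    obtain ⟨n₂, hn₂⟩ := eventually_atTop.1 (hm.eventually_lt_const (u := c) (by simp [hc]))
    refine ⟨max n₁ n₂, fun n hn => ?_⟩
    have e1 := hclose (ν n) f.toContinuousMap (g k)
    have e2 := hclose ν₀ f.toContinuousMap (g k)
    have e3 := hn₁ n (lt_of_le_of_lt (le_max_left _ _) hn)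
    have e4 := hn₂ n ((le_max_right _ _).trans hn.le)
    have key : ∀ a : ℝ, 0 ≤ a → a ≤ c → dist f.toContinuousMap (g k) * a ≤ ε / 4 := by
      intro a ha hac
      calc dist f.toContinuousMap (g k) * a ≤ ε / (4 * c) * c := by gcongr
        _ = ε / 4 := by field_simp
    have e1' := e1.trans (key _ measureReal_nonneg e4.le)
    have e2' := e2.trans (key _ measureReal_nonneg (by simp [hc]))
    rw [dist_comm] at e2'
    calc _ ≤ _ := dist_triangle4 _ (∫ x, g k (φ x) ∂(ν n : Measure E))
            (∫ x, g k (φ x) ∂(ν₀ : Measure E)) _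
      _ < ε := by
        simp only [BoundedContinuousFunction.coe_toContinuousMap] at e1' e2'
        linarith
  refine tendsto_of_tendsto_mass_of_limsup_le hmass fun F hF => ?_
  obtain ⟨C, hC, rfl⟩ := hφ.isInducing.isClosed_iff.1 hF
  have := FiniteMeasure.limsup_measure_closed_le_of_tendsto hmap hC
  simpa only [FiniteMeasure.toMeasure_map, Measure.map_apply hφm hC.measurableSet] using this

/-- The mass and the integrals of a countable dense family in `C(X, ℝ)` are measurable, and their
convergence forces weak convergence. -/
theorem measurable_of_continuous (hE : IsLusin E) {F : FiniteMeasure E → ℝ}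
    (hF : Continuous F) : Measurable F := by
  obtain ⟨X, _, _, φ, hφ, -⟩ := hE
  obtain ⟨g, hg⟩ := TopologicalSpace.exists_dense_seq C(X, ℝ)
  refine measurable_of_seq_tendsto (T := fun ν : FiniteMeasure E =>
    ((ν : Measure E) univ, fun k : ℕ => ∫ x, g k (φ x) ∂(ν : Measure E))) ?_ fun ν ν₀ h => ?_
  · refine (measurable_toMeasure_apply MeasurableSet.univ).prodMk (measurable_pi_lambda _ fun k => ?_)
    exact measurable_integral_toMeasure ((g k).continuous.comp hφ.continuous).measurable
      ⟨‖g k‖, fun x => (g k).norm_coe_le_norm _⟩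
  · rw [nhds_prod_eq, tendsto_prod_iff'] at h
    exact (hF.tendsto _).comp
      (tendsto_of_tendsto_integral_comp hφ hg h.1 fun k => (tendsto_pi_nhds.1 h.2) k)

/-- Probability measures on `M(E)` are determined by the integrals of bounded continuous
functions. -/
theorem ext_of_forall_integral_eq (hE : IsLusin E) {P P' : Measure (FiniteMeasure E)}
    [IsProbabilityMeasure P] [IsProbabilityMeasure P']
    (h : ∀ F : BoundedContinuousFunction (FiniteMeasure E) ℝ, ∫ ν, F ν ∂P = ∫ ν, F ν ∂P') :
    P = P' := by
  have := hE.hasOuterApproxClosed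
  have hmeas : ∀ F : C(FiniteMeasure E, ℝ), Measurable F :=
    fun F => measurable_of_continuous hE F.continuous
  -- Positivity sets are stable under intersection (take minima). They generate the σ-algebra
  -- because evaluation at a closed set is a limit of integrals of continuous functions.
  set S : Set (Set (FiniteMeasure E)) := {s | ∃ F : C(FiniteMeasure E, ℝ), s = {ν | 0 < F ν}}
    with hS
  have hpi : IsPiSystem S := by
    rintro _ ⟨F, rfl⟩ _ ⟨G, rfl⟩ -
    exact ⟨F ⊓ G, by ext; simp⟩
  have hgen : (inferInstance : MeasurableSpace (FiniteMeasure E)) =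
      MeasurableSpace.generateFrom S := by
    refine le_antisymm ?_ (MeasurableSpace.generateFrom_le ?_)
    · have hcont : ∀ F : C(FiniteMeasure E, ℝ), Measurable[MeasurableSpace.generateFrom S] F := by
        intro F
        refine @measurable_of_Ioi ℝ (FiniteMeasure E) _ _ _ (MeasurableSpace.generateFrom S) _ _ _ _ fun a => ?_
        refine MeasurableSpace.measurableSet_generateFrom ⟨F - ContinuousMap.const _ a, ?_⟩
        ext; simp
      suffices hm : Measurable[MeasurableSpace.generateFrom S]
          (fun ν : FiniteMeasure E => (ν : Measure E)) from hm.comap_le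
      refine @Measurable.measure_of_isPiSystem _ _ (MeasurableSpace.generateFrom S) _ _
        (fun ν => ν.isFiniteMeasure) {s | IsClosed s} ?_ ?_ ?_ ?_
      · rw [BorelSpace.measurable_eq (α := E), borel_eq_generateFrom_isClosed]
      · exact isPiSystem_isClosed
      · intro s hs
        refine @ENNReal.measurable_of_tendsto _ (MeasurableSpace.generateFrom S)
          (fun n (ν : FiniteMeasure E) => ∫⁻ x, (IsClosed.apprSeq hs n x : ℝ≥0∞) ∂(ν : Measure E))
          (fun ν : FiniteMeasure E => (ν : Measure E) s) (fun n => ?_) ?_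
        · have := hcont ⟨_, NNReal.continuous_coe.comp
            (FiniteMeasure.continuous_testAgainstNN_eval (hs.apprSeq n))⟩
          have h2 := @Measurable.ennreal_ofReal _ (_) _ this
          convert h2 using 2 with ν
          simp
        · exact tendsto_pi_nhds.2 fun ν =>
            HasOuterApproxClosed.tendsto_lintegral_apprSeq hs (ν : Measure E)
      · have := hcont ⟨_, NNReal.continuous_coe.comp FiniteMeasure.continuous_mass⟩
        have h2 := @Measurable.ennreal_ofReal _ (_) _ this
        convert h2 using 2 with ν
        simp
    · rintro _ ⟨F, rfl⟩
      exact measurableSet_lt measurable_const (hmeas F)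
  refine ext_of_generate_finite S hgen hpi ?_ (by simp)
  rintro _ ⟨F, rfl⟩
  -- On the real line bounded continuous functions determine a finite measure, and composing them
  -- with `F` gives admissible test functions.
  have hmapeq : P.map F = P'.map F := by
    have := Measure.isProbabilityMeasure_map (μ := P) (hmeas F).aemeasurable
    have := Measure.isProbabilityMeasure_map (μ := P') (hmeas F).aemeasurable
    refine ext_of_forall_integral_eq_of_IsFiniteMeasure fun f => ?_
    rw [integral_map (hmeas F).aemeasurable f.continuous.measurable.aestronglyMeasurable,
      integral_map (hmeas F).aemeasurable f.continuous.measurable.aestronglyMeasurable]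
    exact h (f.compContinuous F)
  have := congrArg (fun μ => μ (Ioi 0)) hmapeq
  simp only [Measure.map_apply (hmeas F) measurableSet_Ioi] at this
  exact this

end Topology


/-! ### Series of independent random measures and couplings -/

section Series

variable {E : Type u} [MeasurableSpace E]

instance : MeasurableAdd₂ (FiniteMeasure E) where
  measurable_add := Measurable.subtype_mk
    ((measurable_toMeasure.comp measurable_fst).add (measurable_toMeasure.comp measurable_snd))

theorem tvDist_add_right (μ ρ : FiniteMeasure E) : tvDist μ (μ + ρ) = (ρ : Measure E) univ := by
  have h : (μ : Measure E).toSignedMeasure - ((μ + ρ : FiniteMeasure E) : Measure E).toSignedMeasure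
      = -(ρ : Measure E).toSignedMeasure := by
    have : ((μ + ρ : FiniteMeasure E) : Measure E).toSignedMeasure =
        (μ : Measure E).toSignedMeasure + (ρ : Measure E).toSignedMeasure := by
      rw [← Measure.toSignedMeasure_add]
      exact Measure.toSignedMeasure_congr (FiniteMeasure.toMeasure_add _ _)
    rw [this]; abel
  rw [tvDist, h, SignedMeasure.totalVariation_neg, SignedMeasure.totalVariation_eq_variation,
    Measure.variation_toSignedMeasure]

/-- The pointwise source of the lower bound on `W₁`; the additive form avoids truncated subtraction.
-/
theorem mass_le_add_tvDist (μ ν : FiniteMeasure E) :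
    (ν : Measure E) univ ≤ (μ : Measure E) univ + tvDist μ ν := by
  have h := SignedMeasure.enorm_le_totalVariation
    ((μ : Measure E).toSignedMeasure - (ν : Measure E).toSignedMeasure) univ
  rw [Measure.toSignedMeasure_sub_apply MeasurableSet.univ] at h
  refine le_trans ?_ (add_le_add le_rfl h)
  rw [← ofReal_norm, ← ofReal_measureReal (μ := (ν : Measure E)),
    ← ofReal_measureReal (μ := (μ : Measure E)), ← ENNReal.ofReal_add measureReal_nonneg (norm_nonneg _)]
  refine ENNReal.ofReal_le_ofReal ?_
  have := neg_abs_le ((μ : Measure E).real univ - (ν : Measure E).real univ)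
  rw [Real.norm_eq_abs]
  linarith

open Classical in
/-- The sum of a sequence of finite measures, or `0` if its mass is infinite. -/
noncomputable def seriesSum (γ : ℕ → FiniteMeasure E) : FiniteMeasure E :=
  if h : ∑' i, (γ i : Measure E) univ < ∞ then
    ⟨Measure.sum fun i => (γ i : Measure E),
      ⟨by rwa [Measure.sum_apply _ MeasurableSet.univ]⟩⟩
  else 0

theorem toMeasure_seriesSum {γ : ℕ → FiniteMeasure E} (h : ∑' i, (γ i : Measure E) univ < ∞) :
    (seriesSum γ : Measure E) = Measure.sum fun i => (γ i : Measure E) := by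
  simp [seriesSum, h]

theorem measurable_seriesSum : Measurable (seriesSum (E := E)) := by
  classical
  have hc : ∀ s : Set E, MeasurableSet s →
      Measurable fun γ : ℕ → FiniteMeasure E => ∑' i, (γ i : Measure E) s := fun s hs =>
    Measurable.tsum fun i => (measurable_toMeasure_apply hs).comp (measurable_pi_apply i)
  refine Measurable.subtype_mk (p := IsFiniteMeasure)
    (f := fun γ : ℕ → FiniteMeasure E => (seriesSum γ : Measure E)) ?_
  refine Measure.measurable_of_measurable_coe _ fun s hs => ?_
  have : (fun γ : ℕ → FiniteMeasure E => (seriesSum γ : Measure E) s) = fun γ =>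
      if ∑' i, (γ i : Measure E) univ < ∞ then ∑' i, (γ i : Measure E) s else 0 := by
    funext γ
    by_cases h : ∑' i, (γ i : Measure E) univ < ∞
    · rw [toMeasure_seriesSum h, Measure.sum_apply _ hs, if_pos h]
    · simp [seriesSum, h]
  rw [this]
  exact Measurable.ite (measurableSet_lt (hc _ MeasurableSet.univ) measurable_const) (hc s hs)
    measurable_const

theorem seriesSum_eq_add {γ : ℕ → FiniteMeasure E} (h : ∑' i, (γ i : Measure E) univ < ∞) :
    seriesSum γ = γ 0 + seriesSum fun i => γ (i + 1) := by
  have h' : ∑' i, (γ (i + 1) : Measure E) univ < ∞ := by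
    refine lt_of_le_of_lt ?_ h
    rw [tsum_eq_zero_add' (f := fun i => (γ i : Measure E) univ) ENNReal.summable]
    exact le_add_self
  refine FiniteMeasure.toMeasure_injective ?_
  rw [FiniteMeasure.toMeasure_add, toMeasure_seriesSum h, toMeasure_seriesSum h']
  refine Measure.ext fun s hs => ?_
  rw [Measure.add_apply, Measure.sum_apply _ hs, Measure.sum_apply _ hs,
    tsum_eq_zero_add' ENNReal.summable]

theorem tendsto_sum_seriesSum [TopologicalSpace E] [OpensMeasurableSpace E]
    {γ : ℕ → FiniteMeasure E} (h : ∑' i, (γ i : Measure E) univ < ∞) :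
    Tendsto (fun n => ∑ i ∈ Finset.range (n + 1), γ i) atTop (𝓝 (seriesSum γ)) := by
  refine FiniteMeasure.tendsto_iff_forall_lintegral_tendsto.2 fun f => ?_
  rw [toMeasure_seriesSum h, lintegral_sum_measure]
  simp only [FiniteMeasure.toMeasure_sum, lintegral_finsetSum_measure]
  exact (ENNReal.tendsto_nat_tsum _).comp (tendsto_add_atTop_nat 1)

variable {L : ℕ → Measure (FiniteMeasure E)} [∀ i, IsProbabilityMeasure (L i)]

theorem lintegral_infinitePi_eval {g : FiniteMeasure E → ℝ≥0∞} (hg : Measurable g) (i : ℕ) :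
    ∫⁻ ω, g (ω i) ∂(Measure.infinitePi L) = ∫⁻ ν, g ν ∂(L i) := by
  rw [← Measure.infinitePi_map_eval L i, lintegral_map hg (measurable_pi_apply i)]

/-- By Tonelli the expected total mass is the sum of the first moments. -/
theorem ae_tsum_mass_lt_top (hL : ∑' i, firstMoment (L i) < ∞) :
    ∀ᵐ ω ∂(Measure.infinitePi L), ∑' i, (ω i : Measure E) univ < ∞ := by
  have hm : ∀ i, Measurable fun ω : ℕ → FiniteMeasure E => (ω i : Measure E) univ := fun i =>
    (measurable_toMeasure_apply MeasurableSet.univ).comp (measurable_pi_apply i)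
  refine ae_lt_top (Measurable.tsum hm) ?_
  rw [lintegral_tsum fun i => (hm i).aemeasurable]
  simp_rw [lintegral_infinitePi_eval (L := L) (measurable_toMeasure_apply MeasurableSet.univ)]
  exact hL.ne

theorem lintegral_map_seriesSum (hL : ∑' i, firstMoment (L i) < ∞) {g : E → ℝ≥0∞}
    (hg : Measurable g) :
    ∫⁻ ν, ∫⁻ x, g x ∂(ν : Measure E) ∂((Measure.infinitePi L).map seriesSum) =
      ∑' i, ∫⁻ ν, ∫⁻ x, g x ∂(ν : Measure E) ∂(L i) := by
  have hG := measurable_lintegral_toMeasure hg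
  rw [lintegral_map hG measurable_seriesSum]
  have : ∀ᵐ ω ∂(Measure.infinitePi L), ∫⁻ x, g x ∂(seriesSum ω : Measure E) =
      ∑' i, ∫⁻ x, g x ∂(ω i : Measure E) := by
    filter_upwards [ae_tsum_mass_lt_top hL] with ω hω
    rw [toMeasure_seriesSum hω, lintegral_sum_measure]
  have hGi : ∀ i, Measurable fun ω : ℕ → FiniteMeasure E => ∫⁻ x, g x ∂(ω i : Measure E) :=
    fun i => hG.comp (measurable_pi_apply i)
  rw [lintegral_congr_ae this, lintegral_tsum fun i => (hGi i).aemeasurable]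
  simp_rw [lintegral_infinitePi_eval (L := L) hG]

/-- Coordinates are independent under the product measure, so adding one more coordinate convolves
the law with the next factor. -/
theorem eq_map_sum_of_conv {P : ℕ → Measure (FiniteMeasure E)} (h0 : P 0 = L 0)
    (hs : ∀ n, P (n + 1) = (P n).conv (L (n + 1))) (n : ℕ) :
    P n = (Measure.infinitePi L).map fun ω => ∑ i ∈ Finset.range (n + 1), ω i := by
  induction n with
  | zero => simp [h0, Measure.infinitePi_map_eval]
  | succ n ih =>
    have hind : iIndepFun (fun i (ω : ℕ → FiniteMeasure E) => ω i) (Measure.infinitePi L) :=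
      iIndepFun_infinitePi (X := fun _ ν => ν) fun _ => measurable_id
    have h1 := hind.indepFun_sum_range_succ (fun i => measurable_pi_apply i) (n + 1)
    have e1 : (∑ j ∈ Finset.range (n + 1), fun ω : ℕ → FiniteMeasure E => ω j) =
        fun ω => ∑ i ∈ Finset.range (n + 1), ω i := by ext1 ω; simp
    rw [e1] at h1
    have h2 := h1.map_add_eq_map_conv_map
      (Finset.measurable_fun_sum _ fun i _ => measurable_pi_apply i) (measurable_pi_apply _)
    rw [Measure.infinitePi_map_eval, ← ih, ← hs] at h2
    rw [← h2]
    congr 1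
    funext ω
    simp [Finset.sum_range_succ _ (n + 1)]

theorem tendsto_integral_map_seriesSum [TopologicalSpace E] [BorelSpace E] (hE : IsLusin E)
    (hL : ∑' i, firstMoment (L i) < ∞) {P : ℕ → Measure (FiniteMeasure E)} (h0 : P 0 = L 0)
    (hs : ∀ n, P (n + 1) = (P n).conv (L (n + 1)))
    (F : BoundedContinuousFunction (FiniteMeasure E) ℝ) :
    Tendsto (fun n => ∫ ν, F ν ∂(P n)) atTop
      (𝓝 (∫ ν, F ν ∂((Measure.infinitePi L).map seriesSum))) := by
  have hF : Measurable F := measurable_of_continuous hE F.continuous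
  have hm : ∀ n, Measurable fun ω : ℕ → FiniteMeasure E => ∑ i ∈ Finset.range (n + 1), ω i :=
    fun n => Finset.measurable_fun_sum _ fun i _ => measurable_pi_apply i
  simp_rw [eq_map_sum_of_conv h0 hs]
  rw [integral_map measurable_seriesSum.aemeasurable hF.aestronglyMeasurable]
  simp_rw [integral_map (hm _).aemeasurable hF.aestronglyMeasurable]
  refine tendsto_integral_of_dominated_convergence (fun _ => ‖F‖)
    (fun n => (hF.comp (hm n)).aestronglyMeasurable) (integrable_const _)
    (fun n => ae_of_all _ fun ω => F.norm_coe_le_norm _) ?_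
  filter_upwards [ae_tsum_mass_lt_top hL] with ω hω
  exact (F.continuous.tendsto _).comp (tendsto_sum_seriesSum hω)

/-- The coupling is (first term, whole series); almost surely the two differ by the tail, a positive
measure whose total variation is its mass. -/
theorem W₁_map_seriesSum_le (hL : ∑' i, firstMoment (L i) < ∞) :
    W₁ (L 0) ((Measure.infinitePi L).map seriesSum) ≤ ∑' i, firstMoment (L (i + 1)) := by
  have hm : Measurable fun ω : ℕ → FiniteMeasure E => (ω 0, seriesSum ω) :=
    (measurable_pi_apply 0).prodMk measurable_seriesSum
  have hc : IsCoupling ((Measure.infinitePi L).map fun ω => (ω 0, seriesSum ω)) (L 0)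
      ((Measure.infinitePi L).map seriesSum) := by
    refine ⟨Measure.isProbabilityMeasure_map hm.aemeasurable, ?_, ?_⟩
    · rw [Measure.map_map measurable_fst hm]
      exact Measure.infinitePi_map_eval L 0
    · rw [Measure.map_map measurable_snd hm]
      rfl
  have hle : W₁ (L 0) ((Measure.infinitePi L).map seriesSum) ≤
      ∫⁻ p, tvDist p.1 p.2 ∂((Measure.infinitePi L).map fun ω => (ω 0, seriesSum ω)) := by
    unfold W₁
    exact (iInf_le _ ((Measure.infinitePi L).map fun ω => (ω 0, seriesSum ω))).trans
      (iInf_le _ hc)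
  -- Only this inequality is needed, so measurability of `tvDist` never has to be established.
  refine hle.trans ((lintegral_map_le _ _).trans ?_)
  have hm' : ∀ i, Measurable fun ω : ℕ → FiniteMeasure E => (ω (i + 1) : Measure E) univ := fun i =>
    (measurable_toMeasure_apply MeasurableSet.univ).comp (measurable_pi_apply (i + 1))
  have : ∀ᵐ ω ∂(Measure.infinitePi L), tvDist (ω 0) (seriesSum ω) =
      ∑' i, (ω (i + 1) : Measure E) univ := by
    filter_upwards [ae_tsum_mass_lt_top hL] with ω hω
    have h' : ∑' i, (ω (i + 1) : Measure E) univ < ∞ := by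
      refine lt_of_le_of_lt ?_ hω
      rw [tsum_eq_zero_add' (f := fun i => (ω i : Measure E) univ) ENNReal.summable]
      exact le_add_self
    rw [seriesSum_eq_add hω, tvDist_add_right, toMeasure_seriesSum h',
      Measure.sum_apply _ MeasurableSet.univ]
  rw [lintegral_congr_ae this, lintegral_tsum fun i => (hm' i).aemeasurable]
  simp_rw [lintegral_infinitePi_eval (L := L) (measurable_toMeasure_apply MeasurableSet.univ)]
  exact le_rfl

theorem firstMoment_conv {P P' : Measure (FiniteMeasure E)} [IsProbabilityMeasure P]
    [IsProbabilityMeasure P'] :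
    firstMoment (P.conv P') = firstMoment P + firstMoment P' := by
  have hm := measurable_toMeasure_apply (E := E) MeasurableSet.univ
  rw [firstMoment, Measure.lintegral_conv hm]
  simp only [FiniteMeasure.toMeasure_add, Measure.add_apply]
  simp_rw [lintegral_add_right _ hm]
  rw [lintegral_add_right _ measurable_const]
  simp [firstMoment]

theorem firstMoment_le_add_W₁ (P P' : Measure (FiniteMeasure E)) :
    firstMoment P' ≤ firstMoment P + W₁ P P' := by
  have hm := measurable_toMeasure_apply (E := E) MeasurableSet.univ
  rw [W₁]
  simp only [ENNReal.add_iInf]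
  refine le_iInf₂ fun R hR => ?_
  obtain ⟨-, rfl, rfl⟩ := hR
  rw [firstMoment, firstMoment, lintegral_map hm measurable_snd, lintegral_map hm measurable_fst,
    ← lintegral_add_left (show Measurable fun p : FiniteMeasure E × FiniteMeasure E =>
      (p.1 : Measure E) univ from hm.comp measurable_fst)]
  exact lintegral_mono fun p => mass_le_add_tvDist _ _

end Series


/-! ### First moments from Laplace functionals -/

section Moments

/-- Squeeze with `a * exp (-a) ≤ 1 - exp (-a) ≤ a`; the hypothesis forces `A n → 0`. This passes
from log-Laplace functionals to Laplace functionals. -/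
theorem tendsto_mul_one_sub_exp_neg {A : ℕ → ℝ} {y : ℝ}
    (h : Tendsto (fun n : ℕ => ((n : ℝ) + 1) * A n) atTop (𝓝 y)) :
    Tendsto (fun n : ℕ => ((n : ℝ) + 1) * (1 - Real.exp (-A n))) atTop (𝓝 y) := by
  have hA0 : Tendsto A atTop (𝓝 0) := by
    have := (tendsto_one_div_add_atTop_nhds_zero_nat (𝕜 := ℝ)).mul h
    rw [zero_mul] at this
    refine this.congr fun n => ?_
    field_simp
  have hlow : Tendsto (fun n : ℕ => ((n : ℝ) + 1) * A n * Real.exp (-A n)) atTop (𝓝 y) := by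
    have := h.mul ((Real.continuous_exp.tendsto _).comp hA0.neg)
    simpa using this
  refine tendsto_of_tendsto_of_tendsto_of_le_of_le hlow h (fun n => ?_) (fun n => ?_)
  · have h1 : A n * Real.exp (-A n) ≤ 1 - Real.exp (-A n) := by
      have h2 := Real.add_one_le_exp (A n)
      have h3 := Real.exp_pos (-A n)
      have h4 : Real.exp (A n) * Real.exp (-A n) = 1 := by rw [← Real.exp_add]; simp
      nlinarith
    calc ((n : ℝ) + 1) * A n * Real.exp (-A n) = ((n : ℝ) + 1) * (A n * Real.exp (-A n)) := by ring
      _ ≤ _ := by gcongr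
  · have := Real.add_one_le_exp (-A n)
    have h1 : 1 - Real.exp (-A n) ≤ A n := by linarith
    show ((n : ℝ) + 1) * (1 - Real.exp (-A n)) ≤ ((n : ℝ) + 1) * A n
    gcongr

variable {E : Type u} [MeasurableSpace E]

theorem measurable_mass : Measurable fun ν : FiniteMeasure E => (ν : Measure E).real univ :=
  (measurable_toMeasure_apply MeasurableSet.univ).ennreal_toReal

theorem laplace_const (P : Measure (FiniteMeasure E)) (c : ℝ) :
    laplace P (fun _ => c) = ∫ ν, Real.exp (-((ν : Measure E).real univ * c)) ∂P := by
  simp [laplace, integral_const]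

variable {P : Measure (FiniteMeasure E)} [IsProbabilityMeasure P]

theorem integrable_exp_neg_mass {c : ℝ} (hc : 0 ≤ c) :
    Integrable (fun ν : FiniteMeasure E => Real.exp (-((ν : Measure E).real univ * c))) P := by
  refine Integrable.of_bound ((measurable_mass.mul_const c).neg.exp).aestronglyMeasurable 1
    (ae_of_all _ fun ν => ?_)
  rw [Real.norm_of_nonneg (Real.exp_pos _).le, Real.exp_le_one_iff]
  have : 0 ≤ (ν : Measure E).real univ * c := mul_nonneg measureReal_nonneg hc
  linarith

theorem laplace_const_pos {c : ℝ} (hc : 0 ≤ c) : 0 < laplace P (fun _ => c) := by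
  rw [laplace_const]
  exact integral_exp_pos (integrable_exp_neg_mass hc)

theorem laplace_const_le_one {c : ℝ} (hc : 0 ≤ c) : laplace P (fun _ => c) ≤ 1 := by
  rw [laplace_const]
  have := integral_mono (integrable_exp_neg_mass (P := P) hc) (integrable_const 1) fun ν => by
    simp only [Real.exp_le_one_iff, Left.neg_nonpos_iff]
    exact mul_nonneg measureReal_nonneg hc
  simpa using this

theorem neg_log_laplace_const_nonneg {c : ℝ} (hc : 0 ≤ c) :
    0 ≤ -Real.log (laplace P (fun _ => c)) :=
  neg_nonneg.2 (Real.log_nonpos (laplace_const_pos hc).le (laplace_const_le_one hc))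

theorem exp_neg_neg_log_laplace_const {c : ℝ} (hc : 0 ≤ c) :
    Real.exp (- -Real.log (laplace P (fun _ => c))) = laplace P (fun _ => c) := by
  rw [neg_neg, Real.exp_log (laplace_const_pos hc)]

/-- The first moment as a limit of difference quotients of the Laplace functional at `0`. -/
theorem tendsto_firstMoment (P : Measure (FiniteMeasure E)) [IsProbabilityMeasure P] :
    Tendsto (fun n : ℕ => ENNReal.ofReal
      (((n : ℝ) + 1) * (1 - laplace P (fun _ => 1 / ((n : ℝ) + 1))))) atTop
      (𝓝 (firstMoment P)) := by
  have hc : ∀ n : ℕ, (0 : ℝ) ≤ 1 / ((n : ℝ) + 1) := fun n => by positivity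
  set q : ℕ → FiniteMeasure E → ℝ := fun n ν =>
    ((n : ℝ) + 1) * (1 - Real.exp (-((ν : Measure E).real univ * (1 / ((n : ℝ) + 1))))) with hq
  have hqm : ∀ n, Measurable (q n) := fun n =>
    (measurable_const.sub (measurable_mass.mul_const _).neg.exp).const_mul _
  have hq0 : ∀ n ν, 0 ≤ q n ν := fun n ν => by
    refine mul_nonneg (by positivity) (sub_nonneg.2 (Real.exp_le_one_iff.2 ?_))
    exact neg_nonpos.2 (mul_nonneg measureReal_nonneg (hc n))
  have hqle : ∀ n ν, ENNReal.ofReal (q n ν) ≤ (ν : Measure E) univ := fun n ν => by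
    rw [← ofReal_measureReal (μ := (ν : Measure E))]
    refine ENNReal.ofReal_le_ofReal ?_
    have := Real.add_one_le_exp (-((ν : Measure E).real univ * (1 / ((n : ℝ) + 1))))
    calc q n ν ≤ ((n : ℝ) + 1) * ((ν : Measure E).real univ * (1 / ((n : ℝ) + 1))) := by
          simp only [hq]
          gcongr
          linarith
      _ = _ := by field_simp
  have hqlim : ∀ ν : FiniteMeasure E,
      Tendsto (fun n => ENNReal.ofReal (q n ν)) atTop (𝓝 ((ν : Measure E) univ)) := fun ν => by
    rw [← ofReal_measureReal (μ := (ν : Measure E))]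
    refine (ENNReal.continuous_ofReal.tendsto _).comp (tendsto_mul_one_sub_exp_neg ?_)
    refine tendsto_const_nhds.congr fun n => ?_
    field_simp
  have heq : ∀ n : ℕ, ENNReal.ofReal (((n : ℝ) + 1) * (1 - laplace P (fun _ => 1 / ((n : ℝ) + 1))))
      = ∫⁻ ν, ENNReal.ofReal (q n ν) ∂P := fun n => by
    have hi : Integrable (q n) P :=
      ((integrable_const 1).sub (integrable_exp_neg_mass (hc n))).const_mul _
    rw [← ofReal_integral_eq_lintegral_ofReal hi (ae_of_all _ (hq0 n)), laplace_const, hq,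
      integral_const_mul, integral_sub (integrable_const 1) (integrable_exp_neg_mass (hc n))]
    simp
  simp_rw [heq]
  -- Fatou gives the lower bound and `hqle` the upper one, so an infinite first moment is allowed.
  refine tendsto_of_le_liminf_of_limsup_le ?_ ?_
  · refine le_trans (le_of_eq ?_) (lintegral_liminf_le fun n => (hqm n).ennreal_ofReal)
    exact lintegral_congr fun ν => (hqlim ν).liminf_eq.symm
  · refine limsup_le_of_le (by isBoundedDefault) (Eventually.of_forall fun n => ?_)
    exact lintegral_mono fun ν => hqle n ν

/-- Jensen's inequality for `exp`. It supplies the dominating function in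
`firstMoment_eq_lintegral`. -/
theorem neg_log_laplace_const_le (hP : firstMoment P ≠ ∞) {c : ℝ} (hc : 0 ≤ c) :
    -Real.log (laplace P (fun _ => c)) ≤ c * (firstMoment P).toReal := by
  have hi : Integrable (fun ν : FiniteMeasure E => (ν : Measure E).real univ) P :=
    integrable_toReal_of_lintegral_ne_top
      (measurable_toMeasure_apply MeasurableSet.univ).aemeasurable hP
  have hm : ∫ ν : FiniteMeasure E, (ν : Measure E).real univ ∂P = (firstMoment P).toReal :=
    integral_toReal (measurable_toMeasure_apply MeasurableSet.univ).aemeasurable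
      (ae_of_all _ fun ν => measure_lt_top _ _)
  rw [neg_le, ← Real.exp_le_exp, Real.exp_log (laplace_const_pos hc), laplace_const]
  have := convexOn_exp.map_integral_le (μ := P) Real.continuous_exp.continuousOn isClosed_univ
    (f := fun ν : FiniteMeasure E => -((ν : Measure E).real univ * c)) (ae_of_all _ fun _ => mem_univ _)
    (hi.mul_const c).neg (integrable_exp_neg_mass hc)
  refine le_trans (le_of_eq ?_) this
  rw [integral_neg, integral_mul_const, hm, mul_comm]

theorem tendsto_neg_log_laplace (hP : firstMoment P ≠ ∞) :
    Tendsto (fun n : ℕ => ((n : ℝ) + 1) * -Real.log (laplace P (fun _ => 1 / ((n : ℝ) + 1)))) atTop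
      (𝓝 (firstMoment P).toReal) := by
  have hc : ∀ n : ℕ, (0 : ℝ) ≤ 1 / ((n : ℝ) + 1) := fun n => by positivity
  have h1 := (ENNReal.tendsto_toReal hP).comp (tendsto_firstMoment P)
  refine tendsto_of_tendsto_of_tendsto_of_le_of_le h1 tendsto_const_nhds (fun n => ?_) fun n => ?_
  · have h2 := laplace_const_le_one (P := P) (hc n)
    have h3 := Real.log_le_sub_one_of_pos (laplace_const_pos (P := P) (hc n))
    simp only [Function.comp_apply]
    rw [ENNReal.toReal_ofReal (mul_nonneg (by positivity) (by linarith))]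
    gcongr
    linarith
  · have := neg_log_laplace_const_le hP (hc n)
    calc ((n : ℝ) + 1) * -Real.log (laplace P (fun _ => 1 / ((n : ℝ) + 1)))
        ≤ ((n : ℝ) + 1) * (1 / ((n : ℝ) + 1) * (firstMoment P).toReal) := by gcongr
      _ = _ := by field_simp

/-- Measurability is known only for log-Laplace functionals; the first moment inherits it as a limit
of difference quotients. -/
theorem aemeasurable_firstMoment {S : Type*} [MeasurableSpace S] {μ : Measure S}
    {R : S → Measure (FiniteMeasure E)} (hR : ∀ᵐ x ∂μ, IsProbabilityMeasure (R x))
    (hm : ∀ n : ℕ, AEMeasurable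
      (fun x => -Real.log (laplace (R x) (fun _ => 1 / ((n : ℝ) + 1)))) μ) :
    AEMeasurable (fun x => firstMoment (R x)) μ := by
  refine aemeasurable_of_tendsto_metrizable_ae atTop (f := fun (n : ℕ) x => ENNReal.ofReal
    (((n : ℝ) + 1) * (1 - Real.exp (- -Real.log (laplace (R x) (fun _ => 1 / ((n : ℝ) + 1)))))))
    (fun n => ((aemeasurable_const.sub (hm n).neg.exp).const_mul _).ennreal_ofReal) ?_
  filter_upwards [hR] with x hx
  refine (tendsto_firstMoment (R x)).congr fun n => ?_
  rw [exp_neg_neg_log_laplace_const (by positivity)]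

/-- If the logarithm of the Laplace functional of `P` is a mixture of those of the `R x`, then the
first moment of `P` is the same mixture of the first moments of the `R x`. -/
theorem firstMoment_eq_lintegral {S : Type*} [MeasurableSpace S] {μ : Measure S}
    {R : S → Measure (FiniteMeasure E)} (hR : ∀ᵐ x ∂μ, IsProbabilityMeasure (R x))
    (hm : ∀ n : ℕ, AEMeasurable
      (fun x => -Real.log (laplace (R x) (fun _ => 1 / ((n : ℝ) + 1)))) μ)
    (hfin : ∫⁻ x, firstMoment (R x) ∂μ ≠ ∞)
    (hP : ∀ n : ℕ, laplace P (fun _ => 1 / ((n : ℝ) + 1)) =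
      Real.exp (-∫ x, -Real.log (laplace (R x) (fun _ => 1 / ((n : ℝ) + 1))) ∂μ)) :
    firstMoment P = ∫⁻ x, firstMoment (R x) ∂μ := by
  have hc : ∀ n : ℕ, (0 : ℝ) ≤ 1 / ((n : ℝ) + 1) := fun n => by positivity
  have hmm := aemeasurable_firstMoment hR hm
  have hfin' : ∀ᵐ x ∂μ, firstMoment (R x) < ∞ := ae_lt_top' hmm hfin
  -- Differentiation at zero under the integral over `x`, by dominated convergence.
  have hlim : Tendsto (fun n : ℕ => ((n : ℝ) + 1) *
      ∫ x, -Real.log (laplace (R x) (fun _ => 1 / ((n : ℝ) + 1))) ∂μ) atTop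
      (𝓝 (∫⁻ x, firstMoment (R x) ∂μ).toReal) := by
    rw [← integral_toReal hmm hfin']
    simp_rw [← integral_const_mul]
    refine tendsto_integral_of_dominated_convergence (fun x => (firstMoment (R x)).toReal)
      (fun n => ((hm n).const_mul _).aestronglyMeasurable)
      (integrable_toReal_of_lintegral_ne_top hmm hfin) (fun n => ?_) ?_
    · filter_upwards [hR, hfin'] with x hx hx'
      have h0 := neg_log_laplace_const_nonneg (P := R x) (hc n)
      have := neg_log_laplace_const_le hx'.ne (hc n)
      rw [Real.norm_of_nonneg (by positivity)]
      calc ((n : ℝ) + 1) * -Real.log (laplace (R x) (fun _ => 1 / ((n : ℝ) + 1)))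
          ≤ ((n : ℝ) + 1) * (1 / ((n : ℝ) + 1) * (firstMoment (R x)).toReal) := by gcongr
        _ = _ := by field_simp
    · filter_upwards [hR, hfin'] with x hx hx'
      exact tendsto_neg_log_laplace hx'.ne
  have h1 := (ENNReal.continuous_ofReal.tendsto _).comp (tendsto_mul_one_sub_exp_neg hlim)
  rw [ENNReal.ofReal_toReal hfin] at h1
  refine tendsto_nhds_unique (tendsto_firstMoment P) (h1.congr fun n => ?_)
  rw [Function.comp_apply, ← hP]

end Moments


/-! ### Moments of the semigroup and the limit law -/

section Limit

/-- A function on `ℝ` that converges along every nonnegative monotone sequence tending to `∞`, and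
to `l` along the natural numbers, tends to `l` at `∞`. -/
theorem tendsto_atTop_of_forall_monotone_seq {φ : ℝ → ℝ} {l : ℝ}
    (h : ∀ v : ℕ → ℝ, Monotone v → 0 ≤ v 0 → Tendsto v atTop atTop →
      ∃ l', Tendsto (fun n => φ (v n)) atTop (𝓝 l'))
    (hl : Tendsto (fun n : ℕ => φ n) atTop (𝓝 l)) : Tendsto φ atTop (𝓝 l) := by
  by_contra hcon
  obtain ⟨ε, hε, hbad⟩ : ∃ ε > 0, ∀ T : ℝ, ∃ t ≥ T, ε ≤ dist (φ t) l := by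
    simpa [Metric.tendsto_atTop] using hcon
  have hgood : ∀ T : ℝ, ∃ t ≥ T, dist (φ t) l < ε / 2 := fun T => by
    obtain ⟨n, hn⟩ := Metric.tendsto_atTop.1 hl (ε / 2) (by positivity)
    obtain ⟨k, hk⟩ := exists_nat_ge T
    exact ⟨(max n k : ℕ), hk.trans (by exact_mod_cast le_max_right n k), hn _ (le_max_left _ _)⟩
  choose b hb hb' using hbad
  choose g hg hg' using hgood
  -- Times far from `l` (odd indices) alternate with times close to `l` (even indices from 2 on),
  -- each at least 1 beyond the previous one; no single limit `l'` fits both.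
  set v : ℕ → ℝ := fun n => Nat.rec (motive := fun _ => ℝ) 0
    (fun k x => if Even k then b (x + 1) else g (x + 1)) n with hv
  have hstep : ∀ k, v (k + 1) = if Even k then b (v k + 1) else g (v k + 1) := fun k => rfl
  have hle : ∀ k, v k + 1 ≤ v (k + 1) := fun k => by
    rw [hstep]
    split_ifs
    exacts [hb _, hg _]
  have hmono : Monotone v := monotone_nat_of_le_succ fun k => by linarith [hle k]
  have htop : Tendsto v atTop atTop := by
    have : ∀ k : ℕ, (k : ℝ) ≤ v k := fun k => by
      induction k with
      | zero => simp [hv]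
      | succ k ih => push_cast; linarith [hle k]
    exact tendsto_atTop_mono this tendsto_natCast_atTop_atTop
  obtain ⟨l', hl'⟩ := h v hmono (by simp [hv]) htop
  have h1 : ε ≤ dist l' l := by
    have := (hl'.comp (f := fun k : ℕ => 2 * k + 1)
      (tendsto_atTop_mono (fun k => by simp only [id]; omega) tendsto_id)).dist (tendsto_const_nhds (x := l))
    refine ge_of_tendsto' this fun k => ?_
    simp only [Function.comp_apply, hstep, even_two_mul, if_true]
    exact hb' _
  have h2 : dist l' l ≤ ε / 2 := by
    have := (hl'.comp (f := fun k : ℕ => 2 * k + 1 + 1)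
      (tendsto_atTop_mono (fun k => by simp only [id]; omega) tendsto_id)).dist (tendsto_const_nhds (x := l))
    refine le_of_tendsto' this fun k => ?_
    simp only [Function.comp_apply, hstep (2 * k + 1),
      if_neg (Nat.not_even_iff_odd.2 (odd_two_mul_add_one k))]
    exact (hg' _).le
  linarith

theorem tsum_setLIntegral_Ioc {m : ℝ → ℝ≥0∞} {v : ℕ → ℝ} (hv : Monotone v)
    (htop : Tendsto v atTop atTop) :
    ∑' i, ∫⁻ s in Ioc (v i) (v (i + 1)), m s = ∫⁻ s in Ioi (v 0), m s := by
  have hU : ⋃ i, Ioc (v i) (v (i + 1)) = Ioi (v 0) := by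
    simpa using iUnion_Ioc_map_succ_eq_Ioi (f := v) (fun i => hv (Nat.zero_le i)) (Filter.not_bddAbove_of_tendsto_atTop htop)
  rw [← hU, lintegral_iUnion (fun i => measurableSet_Ioc) ?_]
  simpa using hv.pairwise_disjoint_on_Ioc_succ

theorem setLIntegral_Ioc_add_Ioi {m : ℝ → ℝ≥0∞} {a b : ℝ} (hab : a ≤ b) :
    (∫⁻ s in Ioc a b, m s) + ∫⁻ s in Ioi b, m s = ∫⁻ s in Ioi a, m s := by
  rw [← lintegral_union measurableSet_Ioi (Ioc_disjoint_Ioi le_rfl), Ioc_union_Ioi_eq_Ioi hab]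

variable {E : Type u} [MeasurableSpace E]

theorem measurable_diracM : Measurable (diracM : E → FiniteMeasure E) :=
  Measurable.subtype_mk Measure.measurable_dirac

theorem isBddBorelNonneg_const {c : ℝ} (hc : 0 ≤ c) : IsBddBorelNonneg (fun _ : E => c) :=
  ⟨⟨measurable_const, |c|, fun _ => le_rfl⟩, fun _ => hc⟩

variable {Q : ℝ → Kernel (FiniteMeasure E) (FiniteMeasure E)}

theorem measurable_firstMoment_kernel (κ : Kernel (FiniteMeasure E) (FiniteMeasure E)) :
    Measurable fun x : E => firstMoment (κ (diracM x)) :=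
  ((measurable_toMeasure_apply MeasurableSet.univ).lintegral_kernel (κ := κ)).comp measurable_diracM

theorem BoundedMoments.firstMoment_eq_ofReal (hπ : BoundedMoments Q) {t : ℝ} (ht : 0 ≤ t) (x : E) :
    firstMoment (Q t (diracM x)) = ENNReal.ofReal (moment Q t (fun _ => 1) x) := by
  have hi := (hπ t ht (fun _ => 1) ⟨measurable_const, 1, by simp⟩).1 x
  rw [moment, ofReal_integral_eq_lintegral_ofReal hi
    (ae_of_all _ fun ν => integral_nonneg fun _ => zero_le_one), firstMoment]
  refine lintegral_congr fun ν => ?_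
  simp

/-- The branching property says that the log-Laplace functional of `Q t μ` is the `μ`-mixture of
those of `Q t (diracM x)`; boundedness of `π_t 1` gives finiteness. -/
theorem IsMBSemigroup.firstMoment_eq (hQ : IsMBSemigroup Q) (hπ : BoundedMoments Q) {t : ℝ}
    (ht : 0 ≤ t) (μ : FiniteMeasure E) :
    firstMoment (Q t μ) = ∫⁻ x, firstMoment (Q t (diracM x)) ∂(μ : Measure E) := by
  have := hQ.isMarkovKernel t ht
  have hc : ∀ n : ℕ, IsBddBorelNonneg (fun _ : E => 1 / ((n : ℝ) + 1)) := fun n =>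
    isBddBorelNonneg_const (by positivity)
  refine firstMoment_eq_lintegral (ae_of_all _ fun x => inferInstance)
    (fun n => (hQ.integrable_cumulant t ht μ _ (hc n)).aestronglyMeasurable.aemeasurable) ?_
    fun n => hQ.branching t ht μ _ (hc n)
  obtain ⟨C, hC⟩ := (hπ t ht (fun _ => 1) ⟨measurable_const, 1, by simp⟩).2
  refine ne_of_lt (lt_of_le_of_lt (lintegral_mono (g := fun _ => ENNReal.ofReal C) fun x => ?_) ?_)
  · rw [hπ.firstMoment_eq_ofReal ht]
    exact ENNReal.ofReal_le_ofReal ((le_abs_self _).trans (hC x))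
  · rw [lintegral_const]
    exact ENNReal.mul_lt_top ENNReal.ofReal_lt_top (measure_lt_top _ _)

theorem IsMBSemigroup.firstMoment_bind (hQ : IsMBSemigroup Q) (hπ : BoundedMoments Q) {t : ℝ}
    (ht : 0 ≤ t) (P : Measure (FiniteMeasure E)) :
    firstMoment (P.bind (Q t)) =
      ∫⁻ ν, ∫⁻ x, firstMoment (Q t (diracM x)) ∂(ν : Measure E) ∂P := by
  rw [firstMoment, Measure.lintegral_bind (Q t).measurable.aemeasurable
    (measurable_toMeasure_apply MeasurableSet.univ).aemeasurable]
  exact lintegral_congr fun ν => hQ.firstMoment_eq hπ ht ν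

theorem IsMBSemigroup.bind_bind (hQ : IsMBSemigroup Q) {s t : ℝ} (hs : 0 ≤ s) (ht : 0 ≤ t)
    (P : Measure (FiniteMeasure E)) : (P.bind (Q s)).bind (Q t) = P.bind (Q (s + t)) := by
  rw [Measure.bind_bind (Q s).measurable.aemeasurable (Q t).measurable.aemeasurable]
  congr 1
  funext μ
  exact (hQ.add s t hs ht μ).symm

theorem IsMBSemigroup.firstMoment_zero (hQ : IsMBSemigroup Q) (x : E) :
    firstMoment (Q 0 (diracM x)) = 1 := by
  rw [hQ.zero, Kernel.id_apply, firstMoment,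
    lintegral_dirac' _ (measurable_toMeasure_apply MeasurableSet.univ)]
  exact measure_univ (μ := Measure.dirac x)

variable {K N : ℝ → Measure (FiniteMeasure E)}

theorem firstMoment_eq_setLIntegral (hK : IsInfDivEntranceLaw Q K) (hKint : IsLogIntegrable K)
    (hN : IsSCSemigroup Q N) (hNK : IsGivenBy N K) (hfin : ∫⁻ s in Ioi 0, firstMoment (K s) < ∞)
    {t : ℝ} (ht : 0 ≤ t) : firstMoment (N t) = ∫⁻ s in Ioc 0 t, firstMoment (K s) := by
  have := hN.isProbabilityMeasure t ht
  have hc : ∀ n : ℕ, IsBddBorelNonneg (fun _ : E => 1 / ((n : ℝ) + 1)) := fun n =>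
    isBddBorelNonneg_const (by positivity)
  refine firstMoment_eq_lintegral ?_ (fun n => (hKint.aemeasurable _ (hc n)).mono_measure
    (Measure.restrict_mono Ioc_subset_Ioi_self le_rfl)) ?_ fun n => hNK t ht _ (hc n)
  · exact (ae_restrict_iff' measurableSet_Ioc).2 (ae_of_all _ fun s hs =>
      hK.isProbabilityMeasure s hs.1)
  · exact ((lintegral_mono_set Ioc_subset_Ioi_self).trans_lt hfin).ne

/-- Take first moments in the skew identity and cancel that of `N t`, which is finite. -/
theorem firstMoment_bind_eq_setLIntegral (hQ : IsMBSemigroup Q) (hK : IsInfDivEntranceLaw Q K)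
    (hKint : IsLogIntegrable K) (hN : IsSCSemigroup Q N) (hNK : IsGivenBy N K)
    (hfin : ∫⁻ s in Ioi 0, firstMoment (K s) < ∞) {r t : ℝ} (hr : 0 ≤ r) (ht : 0 ≤ t) :
    firstMoment ((N r).bind (Q t)) = ∫⁻ s in Ioc t (t + r), firstMoment (K s) := by
  have := hN.isProbabilityMeasure t ht
  have := hN.isProbabilityMeasure r hr
  have := hQ.isMarkovKernel t ht
  have h := congrArg firstMoment (hN.skew r t hr ht)
  have hfm : ∀ {t : ℝ}, 0 ≤ t → firstMoment (N t) = ∫⁻ s in Ioc 0 t, firstMoment (K s) :=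
    fun ht => firstMoment_eq_setLIntegral hK hKint hN hNK hfin ht
  rw [firstMoment_conv, hfm ht, hfm (add_nonneg hr ht), add_comm r t,
    ← Ioc_union_Ioc_eq_Ioc ht (le_add_of_nonneg_right hr),
    lintegral_union measurableSet_Ioc (Ioc_disjoint_Ioc_of_le le_rfl), add_comm] at h
  exact ((ENNReal.add_left_inj ((lintegral_mono_set Ioc_subset_Ioi_self).trans_lt hfin).ne).1 h).symm

/-- Along a monotone sequence of times tending to `∞`, the skew convolution semigroup converges
weakly, since the laws are those of the partial sums of a series of independent random measures. -/
theorem exists_limit_of_monotone [TopologicalSpace E] [BorelSpace E] (hE : IsLusin E)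
    (hQ : IsMBSemigroup Q) (hπ : BoundedMoments Q) (hK : IsInfDivEntranceLaw Q K)
    (hKint : IsLogIntegrable K) (hN : IsSCSemigroup Q N) (hNK : IsGivenBy N K)
    (hfin : ∫⁻ s in Ioi 0, firstMoment (K s) < ∞) {v : ℕ → ℝ} (hv : Monotone v) (hv0 : 0 ≤ v 0)
    (htop : Tendsto v atTop atTop) :
    ∃ P : Measure (FiniteMeasure E), IsProbabilityMeasure P ∧
      (∀ F : BoundedContinuousFunction (FiniteMeasure E) ℝ,
        Tendsto (fun n => ∫ ν, F ν ∂(N (v n))) atTop (𝓝 (∫ ν, F ν ∂P))) ∧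
      W₁ (N (v 0)) P ≤ ∫⁻ s in Ioi (v 0), firstMoment (K s) ∧
      ∀ t, 0 ≤ t → ∫⁻ ν, ∫⁻ x, firstMoment (Q t (diracM x)) ∂(ν : Measure E) ∂P =
        ∫⁻ s in Ioi t, firstMoment (K s) := by
  have hvn : ∀ n, 0 ≤ v n := fun n => hv0.trans (hv (Nat.zero_le n))
  have hd : ∀ n, 0 ≤ v (n + 1) - v n := fun n => sub_nonneg.2 (hv (Nat.le_succ n))
  set L : ℕ → Measure (FiniteMeasure E) := fun n =>
    Nat.casesOn n (N (v 0)) fun k => (N (v (k + 1) - v k)).bind (Q (v k))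
  have hL0 : L 0 = N (v 0) := rfl
  have hLs : ∀ k, L (k + 1) = (N (v (k + 1) - v k)).bind (Q (v k)) := fun _ => rfl
  have hNp : ∀ {t : ℝ}, 0 ≤ t → IsProbabilityMeasure (N t) := fun ht =>
    hN.isProbabilityMeasure _ ht
  have hLp : ∀ i, IsProbabilityMeasure (L i) := fun i => by
    cases i with
    | zero => exact hNp hv0
    | succ k =>
      have := hNp (hd k)
      have := hQ.isMarkovKernel _ (hvn k)
      rw [hLs]
      infer_instance
  have hbind : ∀ {r t : ℝ}, 0 ≤ r → 0 ≤ t →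
      firstMoment ((N r).bind (Q t)) = ∫⁻ s in Ioc t (t + r), firstMoment (K s) := fun hr ht =>
    firstMoment_bind_eq_setLIntegral hQ hK hKint hN hNK hfin hr ht
  -- Applying `Q t` shifts the interval carried by each term by `t`; the shifted intervals tile `(t,
  -- ∞)`.
  have hLt : ∀ t, 0 ≤ t → ∑' i, firstMoment ((L i).bind (Q t)) =
      ∫⁻ s in Ioi t, firstMoment (K s) := fun t ht => by
    have hw : Monotone fun i => t + v i := fun i j hij => by simpa using hv hij
    rw [tsum_eq_zero_add' ENNReal.summable, hL0, hbind hv0 ht,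
      ← setLIntegral_Ioc_add_Ioi (le_add_of_nonneg_right hv0),
      ← tsum_setLIntegral_Ioc hw (tendsto_atTop_add_const_left _ t htop)]
    congr 2
    funext i
    rw [hLs, hQ.bind_bind (hvn i) ht, hbind (hd i) (add_nonneg (hvn i) ht)]
    congr 3 <;> ring
  have htail : ∑' i, firstMoment (L (i + 1)) = ∫⁻ s in Ioi (v 0), firstMoment (K s) := by
    rw [← tsum_setLIntegral_Ioc hv htop]
    congr 1
    funext i
    rw [hLs, hbind (hd i) (hvn i), add_sub_cancel]
  have hLfin : ∑' i, firstMoment (L i) < ∞ := by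
    rw [tsum_eq_zero_add' ENNReal.summable, htail, hL0,
      firstMoment_eq_setLIntegral hK hKint hN hNK hfin hv0, setLIntegral_Ioc_add_Ioi hv0]
    exact hfin
  refine ⟨(Measure.infinitePi L).map seriesSum,
    Measure.isProbabilityMeasure_map measurable_seriesSum.aemeasurable, fun F => ?_, ?_, ?_⟩
  · refine tendsto_integral_map_seriesSum hE hLfin hL0.symm (P := fun n => N (v n)) (fun n => ?_) F
    have := hNp (hvn n)
    have := hLp (n + 1)
    rw [Measure.conv_comm, hLs, ← hN.skew _ _ (hd n) (hvn n), sub_add_cancel]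
  · rw [← htail, ← hL0]
    exact W₁_map_seriesSum_le hLfin
  · intro t ht
    rw [lintegral_map_seriesSum hLfin (measurable_firstMoment_kernel (Q t)), ← hLt t ht]
    congr 1
    funext i
    rw [hQ.firstMoment_bind hπ ht]

end Limit

end MBI


theorem theorem4p8 {E : Type u} [TopologicalSpace E] [MeasurableSpace E] [BorelSpace E]
    (hE : MBI.IsLusin E)
    (Q : ℝ → Kernel (FiniteMeasure E) (FiniteMeasure E)) (hQ : MBI.IsMBSemigroup Q)
    (hπ : MBI.BoundedMoments Q)
    (K : ℝ → Measure (FiniteMeasure E)) (hK : MBI.IsInfDivEntranceLaw Q K)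
    (hKint : MBI.IsLogIntegrable K)
    (N : ℝ → Measure (FiniteMeasure E)) (hN : MBI.IsSCSemigroup Q N)
    (hNK : MBI.IsGivenBy N K)
    (hfin : ∫⁻ s in Ioi 0, MBI.firstMoment (K s) < ∞) :
    (∃ Ninf : Measure (FiniteMeasure E), IsProbabilityMeasure Ninf ∧ MBI.WeakLimit N Ninf) ∧
    ∀ Ninf : Measure (FiniteMeasure E), IsProbabilityMeasure Ninf → MBI.WeakLimit N Ninf →
      ∀ t : ℝ, 0 ≤ t →
        MBI.W₁ (N t) Ninf = ∫⁻ s in Ioi t, MBI.firstMoment (K s) ∧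
        ∫⁻ s in Ioi t, MBI.firstMoment (K s) =
          ∫⁻ ν, ∫⁻ x, ENNReal.ofReal (MBI.moment Q t (fun _ => 1) x) ∂(ν : Measure E) ∂Ninf := by
  have hlim := fun (v : ℕ → ℝ) (hv : Monotone v) (hv0 : 0 ≤ v 0) (htop : Tendsto v atTop atTop) =>
    MBI.exists_limit_of_monotone hE hQ hπ hK hKint hN hNK hfin hv hv0 htop
  refine ⟨?_, fun Ninf hp hw t ht => ?_⟩
  · obtain ⟨P, hP, hPlim, -⟩ := hlim (fun n => n) Nat.mono_cast (by simp)
      tendsto_natCast_atTop_atTop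
    refine ⟨P, hP, fun F => MBI.tendsto_atTop_of_forall_monotone_seq (fun v hv hv0 htop => ?_)
      (hPlim F)⟩
    obtain ⟨P', -, h', -⟩ := hlim v hv hv0 htop
    exact ⟨_, h' F⟩
  · have htop : Tendsto (fun n : ℕ => t + n) atTop atTop :=
      tendsto_atTop_add_const_left _ t tendsto_natCast_atTop_atTop
    -- Starting the sequence at `t` makes `N t` the law of the first term, as the optimal coupling
    -- requires.
    obtain ⟨P, hP, hPlim, hW, hPt⟩ := hlim (fun n => t + n)
      (fun i j hij => by simpa using hij) (by simpa using ht) htop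
    obtain rfl : Ninf = P := MBI.ext_of_forall_integral_eq hE fun F =>
      tendsto_nhds_unique ((hw F).comp htop) (hPlim F)
    simp only [Nat.cast_zero, add_zero] at hW
    refine ⟨le_antisymm hW ?_, ?_⟩
    -- At time 0 the moment identity gives the first moment of `Ninf`; cancelling the finite first
    -- moment of `N t` leaves the lower bound.
    · have h0 := hPt 0 le_rfl
      simp only [hQ.firstMoment_zero, lintegral_one] at h0
      have h1 := MBI.firstMoment_le_add_W₁ (N t) Ninf
      have hNt := MBI.firstMoment_eq_setLIntegral hK hKint hN hNK hfin ht
      rw [MBI.firstMoment, h0, ← MBI.setLIntegral_Ioc_add_Ioi ht, ← hNt] at h1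
      refine (ENNReal.add_le_add_iff_left ?_).1 h1
      rw [hNt]
      exact ((lintegral_mono_set Ioc_subset_Ioi_self).trans_lt hfin).ne
    · rw [← hPt t ht]
      simp only [hπ.firstMoment_eq_ofReal ht]
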